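/- **Definitions.** A *BZ-lattice* is an algebra $\mathbf L=(L,\wedge,\vee,{}',{}^{\sim},0,1)$ of type $(2,2,1,1,0,0)$ such that $(L,\wedge,\vee,0,1)$ is a bounded lattice, $a''=a$, $a\le b$ implies $b'\le a'$, $a\wedge a'\le b\vee b'$, $a\wedge a^{\sim}=0$, $a\le a^{\sim\sim}$, $a\le b$ implies $b^{\sim}\le a^{\sim}$, and $a^{\sim\prime}=a^{\sim\sim}$. It is a *PBZ\*-lattice* if moreover $(a\wedge a')^{\sim}\le a^{\sim}\vee a'^{\sim}$ for all $a$, and $a\le b$, $a'\wedge b=0$ imply $a=b$; the class of these is $\mathbb{PBZL}^*$. An *antiortholattice* is a PBZ\*-lattice in which $a\wedge a'=0$ holds only for $a\in\{0,1\}$. Subalgebras and congruences refer to all operations; $a/\theta$ denotes the class of $a$ modulo $\theta$. A congruence $\theta$ is *pseudo-identical* if $0/\theta=\{0\}$ and $1/\theta=\{1\}$; $\mathbf L$ is *simple* if it has exactly two congruences, and *reduced* if the join of all congruences $\theta$ with $0/\theta=\{0\}$ is the identity congruence. The *$0$-assertional logic* of $\mathbb{PBZL}^*$ is the consequence relation on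 terms over countably many variables given by: $\Gamma\vdash\varphi$ iff for every $\mathbf L\in\mathbb{PBZL}^*$ and every assignment $h$ in $\mathbf L$, if $h(\gamma)=0$ for all $\gamma\in\Gamma$ then $h(\varphi)=0$. A logic $\vdash$ is *equivalential* if there is a (possibly infinite) set $\Delta(x,y)$ of terms in two variables such that $\vdash\Delta(x,x)$; $x,\Delta(x,y)\vdash y$; and $\Delta(x_1,y_1),\dots,\Delta(x_n,y_n)\vdash\Delta(f(x_1,\dots,x_n),f(y_1,\dots,y_n))$ for every basic $n$-ary operation $f$. **Theorem.** 1. The $0$-assertional logic of $\mathbb{PBZL}^*$ is not equivalential. 2. Let $\mathbf W$ be the seven-element algebra with universe $\{0,a,b,c,a',b',1\}$ whose lattice reduct is the ordinal sum of the four-element Boolean lattices $\{0,a,b,c\}$ (atoms $a,b$, top $c$) and $\{c,a',b',1\}$ (bottom $c$, coatoms $a',b'$) glued at $c$, with $0'=1$, $c'=c$, $a''=a$, $b''=b$, $1'=0$, and with $0^{\sim}=1$, $x^{\sim}=0$ for $x\neq 0$. Then $\mathbf W$ is a distributive antiortholattice which is simple and reduced. The set $\{0,a,a',1\}$ is a subuniverse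 of $\mathbf W$; the corresponding subalgebra is a PBZ\*-lattice isomorphic to $\mathbf D_4$, the four-element chain $0<d_1<d_2<1$ with its order-reversing involution as ${}'$ and with $0^{\sim}=1$, $x^{\sim}=0$ for $x\ne0$. The equivalence relation on this subalgebra that collapses only $a$ and $a'$ is a pseudo-identical congruence different from the identity, so the subalgebra is not reduced. 3. Consequently the class of reduced members of $\mathbb{PBZL}^*$ is not closed under subalgebras. -/

import Mathlib

namespace PBZ

universe u v

/-- A bounded involution lattice `(A, ⊓, ⊔, ', ⊥, ⊤)`, where `a'` is `kneg a`. -/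
class BoundedInvolutionLattice (A : Type u) extends Lattice A, BoundedOrder A where
  kneg : A → A
  kneg_kneg : ∀ a : A, kneg (kneg a) = a
  kneg_antitone : ∀ a b : A, a ≤ b → kneg b ≤ kneg a

/-- A pseudo-Kleene algebra: a bounded involution lattice with `a ⊓ a' ≤ b ⊔ b'`. -/
class PseudoKleeneAlgebra (A : Type u) extends BoundedInvolutionLattice A where
  inf_kneg_le_sup_kneg : ∀ a b : A, a ⊓ kneg a ≤ b ⊔ kneg b

/-- A Brouwer-Zadeh lattice `(A, ⊓, ⊔, ', ~, ⊥, ⊤)`: the Kleene complement `a'` is `kneg a`,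
the Brouwer complement `a~` is `brouwer a`. -/
class BZLattice (A : Type u) extends PseudoKleeneAlgebra A where
  brouwer : A → A
  inf_brouwer : ∀ a : A, a ⊓ brouwer a = ⊥
  le_brouwer_brouwer : ∀ a : A, a ≤ brouwer (brouwer a)
  brouwer_antitone : ∀ a b : A, a ≤ b → brouwer b ≤ brouwer a
  kneg_brouwer : ∀ a : A, kneg (brouwer a) = brouwer (brouwer a)

open BoundedInvolutionLattice BZLattice

/-- A BZ-lattice is a PBZ*-lattice if it satisfies
`(a ⊓ a')~ ≤ a~ ⊔ □a`, where `□a = a'~`, and is paraorthomodular. -/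
class IsPBZStar (A : Type u) [BZLattice A] : Prop where
  star : ∀ a : A, brouwer (a ⊓ kneg a) ≤ brouwer a ⊔ brouwer (kneg a)
  paraorthomodular : ∀ a b : A, a ≤ b → kneg a ⊓ b = ⊥ → a = b

/-- The Kleene-sharp elements: those with `a ⊓ a' = ⊥`. -/
def kleeneSharp (A : Type u) [BZLattice A] : Set A := {a | a ⊓ kneg a = ⊥}

/-- An antiortholattice: a PBZ*-lattice whose only Kleene-sharp elements are `⊥` and `⊤`. -/
def IsAntiortholattice (A : Type u) [BZLattice A] : Prop :=
  IsPBZStar A ∧ kleeneSharp A = {⊥, ⊤}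

def IsDistributive (A : Type u) [BZLattice A] : Prop :=
  ∀ x y z : A, x ⊓ (y ⊔ z) = (x ⊓ y) ⊔ (x ⊓ z)

/-! ### Congruences -/

/-- A congruence of a BZ-lattice with respect to all the operations of its type. -/
@[ext]
structure Congruence (A : Type u) [BZLattice A] extends Setoid A where
  inf_congr : ∀ {a b c d : A}, r a b → r c d → r (a ⊓ c) (b ⊓ d)
  sup_congr : ∀ {a b c d : A}, r a b → r c d → r (a ⊔ c) (b ⊔ d)
  kneg_congr : ∀ {a b : A}, r a b → r (kneg a) (kneg b)
  brouwer_congr : ∀ {a b : A}, r a b → r (brouwer a) (brouwer b)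

namespace Congruence

variable {A : Type u} [BZLattice A]

/-- The congruence class `a / θ`. -/
def classOf (θ : Congruence A) (a : A) : Set A := {x | θ.r a x}

/-- Congruences are ordered by inclusion. -/
instance : PartialOrder (Congruence A) where
  le θ φ := ∀ a b : A, θ.r a b → φ.r a b
  le_refl _ _ _ h := h
  le_trans _ _ _ h₁ h₂ a b h := h₂ a b (h₁ a b h)
  le_antisymm _ _ h₁ h₂ :=
    Congruence.ext (funext fun a => funext fun b => propext ⟨h₁ a b, h₂ a b⟩)

/-- `⊥` is the identity congruence and `⊤` is the total congruence. -/
instance : BoundedOrder (Congruence A) where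
  bot :=
    { r := fun a b => a = b
      iseqv := ⟨fun _ => rfl, fun h => h.symm, fun h₁ h₂ => h₁.trans h₂⟩
      inf_congr := by rintro a _ c _ rfl rfl; rfl
      sup_congr := by rintro a _ c _ rfl rfl; rfl
      kneg_congr := by rintro a _ rfl; rfl
      brouwer_congr := by rintro a _ rfl; rfl }
  bot_le θ a b h := by cases h; exact θ.iseqv.refl a
  top :=
    { r := fun _ _ => True
      iseqv := ⟨fun _ => trivial, fun _ => trivial, fun _ _ => trivial⟩
      inf_congr := fun _ _ => trivial
      sup_congr := fun _ _ => trivial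
      kneg_congr := fun _ => trivial
      brouwer_congr := fun _ => trivial }
  le_top _ _ _ _ := trivial

/-- A congruence is pseudo-identical if the classes of `⊥` and of `⊤` are singletons. -/
def IsPseudoIdentical (θ : Congruence A) : Prop :=
  θ.classOf ⊥ = {⊥} ∧ θ.classOf ⊤ = {⊤}

end Congruence

/-- Simple: exactly two congruences. -/
def IsSimple (A : Type u) [BZLattice A] : Prop := IsSimpleOrder (Congruence A)

/-- Reduced: the join of all congruences whose `⊥`-class is `{⊥}` is the identity congruence. -/
def IsReduced (A : Type u) [BZLattice A] : Prop :=
  IsLUB {θ : Congruence A | θ.classOf ⊥ = {⊥}} ⊥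

/-! ### Subalgebras and isomorphisms -/

/-- A subalgebra (subuniverse) of a BZ-lattice. -/
structure Subalg (A : Type u) [BZLattice A] where
  carrier : Set A
  inf_mem : ∀ {a b : A}, a ∈ carrier → b ∈ carrier → a ⊓ b ∈ carrier
  sup_mem : ∀ {a b : A}, a ∈ carrier → b ∈ carrier → a ⊔ b ∈ carrier
  kneg_mem : ∀ {a : A}, a ∈ carrier → kneg a ∈ carrier
  brouwer_mem : ∀ {a : A}, a ∈ carrier → brouwer a ∈ carrier
  bot_mem : ⊥ ∈ carrier
  top_mem : ⊤ ∈ carrier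

/-- The universe of a subalgebra as a type. -/
def Subalg.Elem {A : Type u} [BZLattice A] (S : Subalg A) : Type u := {x : A // x ∈ S.carrier}

instance (A : Type u) [BZLattice A] : CoeSort (Subalg A) (Type u) := ⟨Subalg.Elem⟩

/-- A subalgebra is a BZ-lattice under the restricted operations. -/
instance (A : Type u) [BZLattice A] (S : Subalg A) : BZLattice S where
  le x y := x.1 ≤ y.1
  le_refl x := le_refl x.1
  le_trans _ _ _ h₁ h₂ := le_trans (α := A) h₁ h₂
  le_antisymm _ _ h₁ h₂ := Subtype.ext (le_antisymm h₁ h₂)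
  inf x y := ⟨x.1 ⊓ y.1, S.inf_mem x.2 y.2⟩
  sup x y := ⟨x.1 ⊔ y.1, S.sup_mem x.2 y.2⟩
  inf_le_left x y := inf_le_left (a := x.1) (b := y.1)
  inf_le_right x y := inf_le_right (a := x.1) (b := y.1)
  le_inf _ _ _ h₁ h₂ := le_inf (α := A) h₁ h₂
  le_sup_left x y := le_sup_left (a := x.1) (b := y.1)
  le_sup_right x y := le_sup_right (a := x.1) (b := y.1)
  sup_le _ _ _ h₁ h₂ := sup_le (α := A) h₁ h₂
  bot := ⟨⊥, S.bot_mem⟩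
  top := ⟨⊤, S.top_mem⟩
  bot_le x := bot_le (a := x.1)
  le_top x := le_top (a := x.1)
  kneg x := ⟨kneg x.1, S.kneg_mem x.2⟩
  kneg_kneg x := Subtype.ext (kneg_kneg x.1)
  kneg_antitone x y h := kneg_antitone x.1 y.1 h
  inf_kneg_le_sup_kneg x y := PseudoKleeneAlgebra.inf_kneg_le_sup_kneg x.1 y.1
  brouwer x := ⟨brouwer x.1, S.brouwer_mem x.2⟩
  inf_brouwer x := Subtype.ext (inf_brouwer x.1)
  le_brouwer_brouwer x := le_brouwer_brouwer x.1
  brouwer_antitone x y h := brouwer_antitone x.1 y.1 h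
  kneg_brouwer x := Subtype.ext (kneg_brouwer x.1)

/-- An isomorphism of BZ-lattices; an order isomorphism preserves `⊓`, `⊔`, `⊥` and `⊤`. -/
structure Iso (A : Type u) (B : Type v) [BZLattice A] [BZLattice B] extends A ≃o B where
  map_kneg : ∀ a : A, toFun (kneg a) = kneg (toFun a)
  map_brouwer : ∀ a : A, toFun (brouwer a) = brouwer (toFun a)

/-! ### Classes of algebras -/

/-- A class of BZ-lattices. -/
abbrev AlgClass := (A : Type) → [BZLattice A] → Prop

/-- The class of all PBZ*-lattices. -/
def PBZL : AlgClass := fun A _ => IsPBZStar A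

/-- The class of the reduced members of `K`. -/
def reducedMembers (K : AlgClass) : AlgClass := fun A _ => K A ∧ IsReduced A

def ClosedUnderSubalgebras (K : AlgClass) : Prop :=
  ∀ (A : Type) [BZLattice A], K A → ∀ S : Subalg A, K S

/-! ### Sentential logics in the language of BZ-lattices -/

/-- Terms (formulas) of type `(2, 2, 1, 1, 0, 0)` over a set of variables. -/
inductive BZTerm (X : Type) : Type
  | var : X → BZTerm X
  | inf : BZTerm X → BZTerm X → BZTerm X
  | sup : BZTerm X → BZTerm X → BZTerm X
  | kneg : BZTerm X → BZTerm X
  | brouwer : BZTerm X → BZTerm X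
  | zero : BZTerm X
  | one : BZTerm X

namespace BZTerm

/-- Simultaneous substitution. -/
def subst {X Y : Type} (σ : X → BZTerm Y) : BZTerm X → BZTerm Y
  | var x => σ x
  | inf s t => inf (s.subst σ) (t.subst σ)
  | sup s t => sup (s.subst σ) (t.subst σ)
  | kneg t => kneg (t.subst σ)
  | brouwer t => brouwer (t.subst σ)
  | zero => zero
  | one => one

/-- The value of a term in a BZ-lattice under an assignment. -/
def eval {X : Type} {A : Type u} [BZLattice A] (h : X → A) : BZTerm X → A
  | var x => h x
  | inf s t => s.eval h ⊓ t.eval h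
  | sup s t => s.eval h ⊔ t.eval h
  | kneg t => BoundedInvolutionLattice.kneg (t.eval h)
  | brouwer t => BZLattice.brouwer (t.eval h)
  | zero => ⊥
  | one => ⊤

theorem eval_subst {X Y : Type} {A : Type u} [BZLattice A] (σ : X → BZTerm Y) (h : Y → A)
    (t : BZTerm X) : (t.subst σ).eval h = t.eval fun x => (σ x).eval h := by
  induction t <;> simp_all [subst, eval]

end BZTerm

/-- Formulas: terms over countably many variables. -/
abbrev Formula := BZTerm ℕ

/-- A sentential logic: a substitution-invariant consequence relation on formulas. -/
structure SententialLogic where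
  entails : Set Formula → Formula → Prop
  axm : ∀ {Γ : Set Formula} {φ : Formula}, φ ∈ Γ → entails Γ φ
  cut : ∀ {Γ Δ : Set Formula} {φ : Formula},
    (∀ ψ ∈ Δ, entails Γ ψ) → entails Δ φ → entails Γ φ
  structural : ∀ {Γ : Set Formula} {φ : Formula} (σ : ℕ → Formula),
    entails Γ φ → entails (BZTerm.subst σ '' Γ) (φ.subst σ)

/-- The `0`-assertional logic of `K`: `Γ ⊢ φ` iff every assignment into a member of `K` that
sends all of `Γ` to `0` sends `φ` to `0`. Since there are countably many variables and `K` is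
meant to be closed under subalgebras, algebras in `Type` suffice. -/
def assertionalLogic (K : AlgClass) : SententialLogic where
  entails Γ φ := ∀ (A : Type) [BZLattice A], K A → ∀ h : ℕ → A,
    (∀ γ ∈ Γ, BZTerm.eval h γ = ⊥) → BZTerm.eval h φ = ⊥
  axm hφ _ _ _ _ hΓ := hΓ _ hφ
  cut hΔ hφ A _ hA h hΓ := hφ A hA h fun ψ hψ => hΔ ψ hψ A hA h hΓ
  structural σ hφ A _ hA h hΓ := by
    rw [BZTerm.eval_subst]
    refine hφ A hA _ fun γ hγ => ?_
    rw [← BZTerm.eval_subst]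
    exact hΓ _ ⟨γ, hγ, rfl⟩

/-- `Δ(s, t)` for a set `Δ(x, y)` of formulas in two variables. -/
def inst (Δ : Set (BZTerm (Fin 2))) (s t : Formula) : Set Formula :=
  BZTerm.subst ![s, t] '' Δ

/-- `Δ(x, y)` is a system of equivalence formulas for the logic: reflexivity, detachment and the
replacement property for every operation. Symmetry and transitivity are consequences of these, and
replacement for constants is an instance of reflexivity. -/
structure SententialLogic.IsEquivalenceSystem (L : SententialLogic)
    (Δ : Set (BZTerm (Fin 2))) : Prop where
  refl : ∀ s : Formula, ∀ δ ∈ inst Δ s s, L.entails ∅ δ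
  detachment : ∀ s t : Formula, L.entails ({s} ∪ inst Δ s t) t
  replace_inf : ∀ s₁ t₁ s₂ t₂ : Formula, ∀ δ ∈ inst Δ (.inf s₁ s₂) (.inf t₁ t₂),
    L.entails (inst Δ s₁ t₁ ∪ inst Δ s₂ t₂) δ
  replace_sup : ∀ s₁ t₁ s₂ t₂ : Formula, ∀ δ ∈ inst Δ (.sup s₁ s₂) (.sup t₁ t₂),
    L.entails (inst Δ s₁ t₁ ∪ inst Δ s₂ t₂) δ
  replace_kneg : ∀ s t : Formula, ∀ δ ∈ inst Δ (.kneg s) (.kneg t),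
    L.entails (inst Δ s t) δ
  replace_brouwer : ∀ s t : Formula, ∀ δ ∈ inst Δ (.brouwer s) (.brouwer t),
    L.entails (inst Δ s t) δ

/-- A logic is equivalential if it has a (possibly infinite) system of equivalence formulas. -/
def SententialLogic.IsEquivalential (L : SententialLogic) : Prop :=
  ∃ Δ : Set (BZTerm (Fin 2)), L.IsEquivalenceSystem Δ

/-! ### The four-element antiortholattice chain -/

/-- The universe `0 < d₁ < d₂ < 1` of the four-element chain. -/
def D4 : Type := Fin 4

instance : Lattice D4 := inferInstanceAs (Lattice (Fin 4))
instance : BoundedOrder D4 := inferInstanceAs (BoundedOrder (Fin 4))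

/-- The four-element Kleene chain with the trivial Brouwer complement. -/
instance : BZLattice D4 where
  kneg := fun x : Fin 4 => x.rev
  kneg_kneg := (by decide : ∀ x : Fin 4, x.rev.rev = x)
  kneg_antitone := (by decide : ∀ x y : Fin 4, x ≤ y → y.rev ≤ x.rev)
  inf_kneg_le_sup_kneg := (by decide : ∀ x y : Fin 4, x ⊓ x.rev ≤ y ⊔ y.rev)
  brouwer := fun x : Fin 4 => (if x = 0 then 3 else 0 : Fin 4)
  inf_brouwer := (by decide : ∀ x : Fin 4, x ⊓ (if x = 0 then 3 else 0) = 0)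
  le_brouwer_brouwer := (by decide : ∀ x : Fin 4,
    x ≤ (if (if x = 0 then 3 else 0 : Fin 4) = 0 then 3 else 0))
  brouwer_antitone := (by decide : ∀ x y : Fin 4, x ≤ y →
    (if y = 0 then 3 else 0 : Fin 4) ≤ (if x = 0 then 3 else 0))
  kneg_brouwer := (by decide : ∀ x : Fin 4, (if x = 0 then 3 else 0 : Fin 4).rev =
    (if (if x = 0 then 3 else 0 : Fin 4) = 0 then 3 else 0))

/-! ### The seven-element antiortholattice -/

/-- The universe of the ordinal sum of the four-element Boolean lattice with itself: the top
`c` of the lower copy `{zero, a, b, c}` is the bottom of the upper copy `{c, na, nb, one}`. -/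
inductive W : Type
  | zero | a | b | c | na | nb | one
  deriving DecidableEq

namespace W

/-- The height of an element. -/
def height : W → ℕ
  | zero => 0
  | a => 1
  | b => 1
  | c => 2
  | na => 3
  | nb => 3
  | one => 4

/-- Distinct elements are comparable exactly when their heights differ. -/
instance : LE W := ⟨fun x y => x = y ∨ x.height < y.height⟩

instance (x y : W) : Decidable (x ≤ y) :=
  inferInstanceAs (Decidable (x = y ∨ x.height < y.height))

/-- The meet of two comparable elements is the smaller one, `a ⊓ b = zero`, `na ⊓ nb = c`. -/
def meet (x y : W) : W :=
  if x ≤ y then x else if y ≤ x then y else if x.height = 1 then zero else c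

/-- The join of two comparable elements is the larger one, `a ⊔ b = c`, `na ⊔ nb = one`. -/
def join (x y : W) : W :=
  if x ≤ y then y else if y ≤ x then x else if x.height = 1 then c else one

/-- The Kleene complement. -/
def compl : W → W
  | zero => one
  | a => na
  | b => nb
  | c => c
  | na => a
  | nb => b
  | one => zero

/-- The trivial Brouwer complement. -/
def brw (x : W) : W := if x = zero then one else zero

instance : BZLattice W where
  le_refl _ := Or.inl rfl
  le_trans := by intro x y z; cases x <;> cases y <;> cases z <;> decide
  le_antisymm := by intro x y; cases x <;> cases y <;> decide
  inf := meet
  sup := join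
  inf_le_left := by intro x y; cases x <;> cases y <;> decide
  inf_le_right := by intro x y; cases x <;> cases y <;> decide
  le_inf := by intro x y z; cases x <;> cases y <;> cases z <;> decide
  le_sup_left := by intro x y; cases x <;> cases y <;> decide
  le_sup_right := by intro x y; cases x <;> cases y <;> decide
  sup_le := by intro x y z; cases x <;> cases y <;> cases z <;> decide
  bot := zero
  top := one
  bot_le := by intro x; cases x <;> decide
  le_top := by intro x; cases x <;> decide
  kneg := compl
  kneg_kneg := by intro x; cases x <;> decide
  kneg_antitone := by intro x y; cases x <;> cases y <;> decide
  inf_kneg_le_sup_kneg := by intro x y; cases x <;> cases y <;> decide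
  brouwer := brw
  inf_brouwer := by intro x; cases x <;> decide
  le_brouwer_brouwer := by intro x; cases x <;> decide
  brouwer_antitone := by intro x y; cases x <;> cases y <;> decide
  kneg_brouwer := by intro x; cases x <;> decide

end W

end PBZ

namespace PBZ

open BoundedInvolutionLattice BZLattice

namespace W

/-! Everything rests on the position of `b`: `a ⊓ b = 0`, whereas `b < na`. In `W` meets with `b`
therefore separate `a` from `na`, but `b` is missing from `{0, a, na, 1}`, where the two can be
identified without disturbing `0` or `1`. In general, an element of `W` is determined by its
annihilator and that of its Kleene complement, so a nontrivial congruence puts some `z ≠ 0` in the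
class of `0` (`exists_bot_rel`). The Brouwer complement then gives `1 ≡ 0`. Hence `W` is simple and
reduced, while the chain is not reduced. For the logic, suppose `Δ` is a system of equivalence
formulas. The values of `Δ(a, a)` are all `0`, and `Collapse.eval` carries this over to `Δ(a, na)`.
Replacement for meets with `b` makes `Δ(0, b)` hold, and detachment yields `b = 0`. -/

instance : Fintype W := ⟨{zero, a, b, c, na, nb, one}, fun x => by cases x <;> decide⟩

/-! ### `W` as a distributive antiortholattice -/

theorem isPBZStar : IsPBZStar W where
  star := by
    intro x
    change (_ : W) = _ ∨ height _ < height _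
    cases x <;> decide
  paraorthomodular := by
    intro x y
    change (x = y ∨ height x < height y) → compl x ⊓ y = zero → x = y
    cases x <;> cases y <;> decide

theorem kleeneSharp_eq : kleeneSharp W = {⊥, ⊤} := by
  ext x
  change x ⊓ compl x = zero ↔ x = zero ∨ x = one
  cases x <;> decide

theorem isAntiortholattice : IsAntiortholattice W := ⟨isPBZStar, kleeneSharp_eq⟩

theorem isDistributive : IsDistributive W := by
  intro x y z
  cases x <;> cases y <;> cases z <;> decide

/-! ### Congruences of `W` -/

/-- Distinct elements are separated by the annihilators of some element, either directly or after
taking Kleene complements. -/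
theorem exists_inf_separates (x y : W) (h : x ≠ y) :
    ∃ m : W, (x ⊓ m = zero ∧ y ⊓ m ≠ zero) ∨ (y ⊓ m = zero ∧ x ⊓ m ≠ zero) ∨
      (compl x ⊓ m = zero ∧ compl y ⊓ m ≠ zero) ∨
      (compl y ⊓ m = zero ∧ compl x ⊓ m ≠ zero) := by
  -- The annihilators of `0`, `a`, `b` are `W`, `{0, b}`, `{0, a}`; every other element has
  -- annihilator `{0}`. Complementation turns `one`, `na`, `nb` into `0`, `a`, `b` and fixes `c`.
  revert h
  cases x <;> cases y <;> decide

/-- A nontrivial congruence of `W` has a nontrivial class of `⊥`. -/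
theorem exists_bot_rel (θ : Congruence W) {x y : W} (hne : x ≠ y) (h : θ.r x y) :
    ∃ z : W, z ≠ zero ∧ θ.r zero z := by
  have key : ∀ {x y : W}, θ.r x y → ∀ m, x ⊓ m = zero → y ⊓ m ≠ zero →
      ∃ z : W, z ≠ zero ∧ θ.r zero z := fun {x y} h m hx hy =>
    ⟨y ⊓ m, hy, hx ▸ θ.inf_congr h (θ.iseqv.refl m)⟩
  obtain ⟨m, ⟨hx, hy⟩ | ⟨hy, hx⟩ | ⟨hx, hy⟩ | ⟨hy, hx⟩⟩ := exists_inf_separates x y hne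
  · exact key h m hx hy
  · exact key (θ.iseqv.symm h) m hy hx
  · exact key (θ.kneg_congr h) m hx hy
  · exact key (θ.iseqv.symm (θ.kneg_congr h)) m hy hx

theorem congruence_eq_bot_of_classOf_bot {θ : Congruence W} (h : θ.classOf ⊥ = {⊥}) : θ = ⊥ := by
  refine le_antisymm (fun x y hxy => ?_) bot_le
  by_contra hne
  obtain ⟨z, hz, h0⟩ := exists_bot_rel θ hne hxy
  exact hz (h.subset h0)

theorem isSimple : IsSimple W where
  exists_pair_ne := ⟨⊥, ⊤, fun h => by
    have h' : (⊥ : Congruence W).r zero one := by rw [h]; trivial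
    exact absurd (show zero = one from h') (by decide)⟩
  eq_bot_or_eq_top θ := by
    refine or_iff_not_imp_left.2 fun hθ => ?_
    have hex : ∃ z : W, z ≠ zero ∧ θ.r zero z := by
      by_contra hcon
      refine hθ (congruence_eq_bot_of_classOf_bot ?_)
      ext z
      refine ⟨fun hz => by_contra fun hne => hcon ⟨z, hne, hz⟩, ?_⟩
      rintro rfl
      exact θ.iseqv.refl _
    obtain ⟨z, hz, h0⟩ := hex
    -- The Brouwer complement sends `0` to `1` and the nonzero `z` to `0`.
    have h10 : θ.r one zero := by
      have := θ.brouwer_congr h0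
      change θ.r (brw zero) (brw z) at this
      rwa [brw, brw, if_pos rfl, if_neg hz] at this
    refine le_antisymm le_top fun x y _ => ?_
    have hall : ∀ x : W, θ.r x zero := fun x => by
      have := θ.inf_congr (θ.iseqv.refl x) h10
      rwa [show x ⊓ one = x by cases x <;> decide,
        show x ⊓ zero = zero by cases x <;> decide] at this
    exact θ.iseqv.trans (hall x) (θ.iseqv.symm (hall y))

theorem isReduced : IsReduced W :=
  ⟨fun _ hθ => (congruence_eq_bot_of_classOf_bot hθ).le, fun _ _ => bot_le⟩

/-! ### The four-element chain inside `W` -/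

/-- The subalgebra `{zero, a, na, one}`. -/
def chain : Subalg W where
  carrier := {zero, a, na, one}
  inf_mem := by
    rintro x y (rfl | rfl | rfl | rfl) (rfl | rfl | rfl | rfl) <;>
      (change _ = zero ∨ _ = a ∨ _ = na ∨ _ = one; decide)
  sup_mem := by
    rintro x y (rfl | rfl | rfl | rfl) (rfl | rfl | rfl | rfl) <;>
      (change _ = zero ∨ _ = a ∨ _ = na ∨ _ = one; decide)
  kneg_mem := by
    rintro x (rfl | rfl | rfl | rfl) <;>
      (change _ = zero ∨ _ = a ∨ _ = na ∨ _ = one; decide)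
  brouwer_mem := by
    rintro x (rfl | rfl | rfl | rfl) <;>
      (change _ = zero ∨ _ = a ∨ _ = na ∨ _ = one; decide)
  bot_mem := .inl rfl
  top_mem := .inr (.inr (.inr rfl))

end W

/-- A subalgebra of a PBZ*-lattice is a PBZ*-lattice. -/
theorem IsPBZStar.subalg {A : Type u} [BZLattice A] (hA : IsPBZStar A) (S : Subalg A) :
    IsPBZStar S where
  star x := hA.star x.1
  paraorthomodular x y h h0 :=
    Subtype.ext (hA.paraorthomodular x.1 y.1 h (congrArg Subtype.val h0))

namespace W

/-- The isomorphism of `chain` with `D4`. -/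
def chainIso : Iso chain D4 where
  toFun x := (match x.1 with
    -- The values at `b`, `c`, `nb` are arbitrary: these elements lie outside the subalgebra.
    | zero => 0 | a => 1 | b => 1 | c => 1 | na => 2 | nb => 2 | one => 3 : Fin 4)
  invFun := fun i : Fin 4 => match i with
    | 0 => ⟨zero, .inl rfl⟩
    | 1 => ⟨a, .inr (.inl rfl)⟩
    | 2 => ⟨na, .inr (.inr (.inl rfl))⟩
    | 3 => ⟨one, .inr (.inr (.inr rfl))⟩
  left_inv := by rintro ⟨x, rfl | rfl | rfl | rfl⟩ <;> rfl
  right_inv := fun i : Fin 4 => by fin_cases i <;> rfl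
  map_rel_iff' := by
    rintro ⟨x, rfl | rfl | rfl | rfl⟩ ⟨y, rfl | rfl | rfl | rfl⟩ <;>
      (change (_ : Fin 4) ≤ _ ↔ (_ : W) = _ ∨ height _ < height _; decide)
  map_kneg := by rintro ⟨x, rfl | rfl | rfl | rfl⟩ <;> rfl
  map_brouwer := by rintro ⟨x, rfl | rfl | rfl | rfl⟩ <;> rfl

/-! ### Collapsing `a` and `na` -/

/-- Two elements of `{zero, a, na, one}` are equal or both lie in `{a, na}`. -/
def Collapse (x y : W) : Prop :=
  (x = zero ∧ y = zero) ∨ (x = one ∧ y = one) ∨ ((x = a ∨ x = na) ∧ (y = a ∨ y = na))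

instance (x y : W) : Decidable (Collapse x y) := by unfold Collapse; infer_instance

theorem Collapse.inf {x y z w : W} : Collapse x y → Collapse z w → Collapse (x ⊓ z) (y ⊓ w) := by
  rintro (⟨rfl, rfl⟩ | ⟨rfl, rfl⟩ | ⟨rfl | rfl, rfl | rfl⟩)
    (⟨rfl, rfl⟩ | ⟨rfl, rfl⟩ | ⟨rfl | rfl, rfl | rfl⟩) <;> decide

theorem Collapse.sup {x y z w : W} : Collapse x y → Collapse z w → Collapse (x ⊔ z) (y ⊔ w) := by
  rintro (⟨rfl, rfl⟩ | ⟨rfl, rfl⟩ | ⟨rfl | rfl, rfl | rfl⟩)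
    (⟨rfl, rfl⟩ | ⟨rfl, rfl⟩ | ⟨rfl | rfl, rfl | rfl⟩) <;> decide

theorem Collapse.kneg {x y : W} : Collapse x y →
    Collapse (BoundedInvolutionLattice.kneg x) (BoundedInvolutionLattice.kneg y) := by
  rintro (⟨rfl, rfl⟩ | ⟨rfl, rfl⟩ | ⟨rfl | rfl, rfl | rfl⟩) <;> decide

theorem Collapse.brouwer {x y : W} : Collapse x y →
    Collapse (BZLattice.brouwer x) (BZLattice.brouwer y) := by
  rintro (⟨rfl, rfl⟩ | ⟨rfl, rfl⟩ | ⟨rfl | rfl, rfl | rfl⟩) <;> decide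

theorem Collapse.symm {x y : W} (h : Collapse x y) : Collapse y x := by
  unfold Collapse at *; tauto

theorem Collapse.trans {x y z : W} : Collapse x y → Collapse y z → Collapse x z := by
  rintro (⟨rfl, rfl⟩ | ⟨rfl, rfl⟩ | ⟨rfl | rfl, rfl | rfl⟩)
    (⟨h, rfl⟩ | ⟨h, rfl⟩ | ⟨h | h, rfl | rfl⟩) <;> first | decide | cases h

theorem Collapse.refl_of_mem {x : W} (h : x ∈ chain.carrier) : Collapse x x := by
  rcases h with rfl | rfl | rfl | rfl <;> decide

/-- Compatibility with the operations extends to terms by induction. Stating it in `W`, where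
`Collapse` is only a partial equivalence, lets it be combined directly with meets by `b`. -/
theorem Collapse.eval {X : Type} {h k : X → W} (hk : ∀ x, Collapse (h x) (k x)) (t : BZTerm X) :
    Collapse (t.eval h) (t.eval k) := by
  induction t with
  | var x => exact hk x
  | inf s t hs ht => exact hs.inf ht
  | sup s t hs ht => exact hs.sup ht
  | kneg t ht => exact ht.kneg
  | brouwer t ht => exact ht.brouwer
  | zero => exact .inl ⟨rfl, rfl⟩
  | one => exact .inr (.inl ⟨rfl, rfl⟩)

/-- The congruence of `chain` that identifies `a` and `na`. -/
def collapse : Congruence chain where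
  r x y := Collapse x.1 y.1
  iseqv := ⟨fun x => Collapse.refl_of_mem x.2, Collapse.symm, Collapse.trans⟩
  inf_congr := Collapse.inf
  sup_congr := Collapse.sup
  kneg_congr := Collapse.kneg
  brouwer_congr := Collapse.brouwer

theorem collapse_rel_iff (x y : chain) : collapse.r x y ↔
    x = y ∨ (x.1 ∈ ({a, na} : Set W) ∧ y.1 ∈ ({a, na} : Set W)) := by
  constructor
  · rintro (⟨hx, hy⟩ | ⟨hx, hy⟩ | h)
    · exact .inl (Subtype.ext (hx.trans hy.symm))
    · exact .inl (Subtype.ext (hx.trans hy.symm))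
    · exact .inr h
  · rintro (rfl | h)
    · exact collapse.iseqv.refl x
    · exact .inr (.inr h)

theorem collapse_ne_bot : collapse ≠ ⊥ := fun h => by
  have h' : collapse.r ⟨a, .inr (.inl rfl)⟩ ⟨na, .inr (.inr (.inl rfl))⟩ :=
    .inr (.inr ⟨.inl rfl, .inr rfl⟩)
  rw [h] at h'
  exact absurd (congrArg Subtype.val h' : a = na) (by decide)

theorem collapse_isPseudoIdentical : collapse.IsPseudoIdentical := by
  constructor
  · ext x
    refine ⟨fun h => ?_, fun h => h ▸ collapse.iseqv.refl _⟩
    rcases h with ⟨-, h⟩ | ⟨h, -⟩ | ⟨h | h, -⟩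
    · exact Subtype.ext h
    all_goals cases h
  · ext x
    refine ⟨fun h => ?_, fun h => h ▸ collapse.iseqv.refl _⟩
    rcases h with ⟨h, -⟩ | ⟨-, h⟩ | ⟨h | h, -⟩
    · cases h
    · exact Subtype.ext h
    all_goals cases h

theorem not_isReduced_chain : ¬ IsReduced chain := fun h =>
  collapse_ne_bot (le_antisymm (h.1 collapse_isPseudoIdentical.1) bot_le)

end W

/-! ### Failure of equivalentiality and of closure under subalgebras -/

theorem not_isEquivalential_PBZL : ¬ (assertionalLogic PBZL).IsEquivalential := by
  rintro ⟨Δ, hΔ⟩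
  -- `R x y` says that `Δ(x, y)` holds in the matrix `⟨W, {⊥}⟩`.
  let R : W → W → Prop := fun x y => ∀ δ ∈ Δ, BZTerm.eval ![x, y] δ = ⊥
  have eval_inst : ∀ (h : ℕ → W) (s t : Formula),
      (∀ δ ∈ inst Δ s t, BZTerm.eval h δ = ⊥) ↔ R (s.eval h) (t.eval h) := by
    intro h s t
    have hfun : (fun i => BZTerm.eval h (![s, t] i)) = ![s.eval h, t.eval h] := by
      ext i; fin_cases i <;> rfl
    simp only [inst, Set.forall_mem_image, BZTerm.eval_subst, hfun, R]
  have refl : ∀ x, R x x := fun x =>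
    (eval_inst (fun _ => x) (.var 0) (.var 0)).1 fun δ hδ =>
      hΔ.refl _ δ hδ W W.isPBZStar _ (by simp)
  have inf : ∀ {x y z w}, R x y → R z w → R (x ⊓ z) (y ⊓ w) := by
    intro x y z w hxy hzw
    let h : ℕ → W := fun n => match n with | 0 => x | 1 => y | 2 => z | _ => w
    refine (eval_inst h (.inf (.var 0) (.var 2)) (.inf (.var 1) (.var 3))).1 fun δ hδ =>
      hΔ.replace_inf (.var 0) (.var 1) (.var 2) (.var 3) δ hδ W W.isPBZStar h ?_
    rintro γ (hγ | hγ)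
    · exact (eval_inst h (.var 0) (.var 1)).2 hxy γ hγ
    · exact (eval_inst h (.var 2) (.var 3)).2 hzw γ hγ
  have detach : ∀ {y}, R ⊥ y → y = ⊥ := by
    intro y hy
    let h : ℕ → W := fun n => match n with | 0 => ⊥ | _ => y
    refine hΔ.detachment (.var 0) (.var 1) W W.isPBZStar h ?_
    rintro γ (rfl | hγ)
    · rfl
    · exact (eval_inst h (.var 0) (.var 1)).2 hy γ hγ
  have hana : R W.a W.na := by
    intro δ hδ
    -- The left value is `0` by reflexivity, and `Collapse` relates `0` only to itself.
    have hc : W.Collapse (BZTerm.eval ![W.a, W.a] δ) (BZTerm.eval ![W.a, W.na] δ) :=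
      W.Collapse.eval (fun i => by fin_cases i <;> simp [W.Collapse]) δ
    rw [refl W.a δ hδ] at hc
    rcases hc with ⟨-, h⟩ | ⟨h, -⟩ | ⟨h | h, -⟩
    · exact h
    all_goals cases h
  -- Here `a ⊓ b = 0` and `na ⊓ b = b`.
  have h0b : R W.zero W.b := inf hana (refl W.b)
  exact absurd (detach h0b : W.b = W.zero) (by decide)

theorem not_closedUnderSubalgebras_reducedMembers_PBZL :
    ¬ ClosedUnderSubalgebras (reducedMembers PBZL) := fun h =>
  W.not_isReduced_chain (h W ⟨W.isPBZStar, W.isReduced⟩ W.chain).2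

end PBZ

theorem mainTheorem9 :
    -- the logic is not equivalential
    ¬ (PBZ.assertionalLogic PBZ.PBZL).IsEquivalential ∧
    -- the witness is a simple, reduced, distributive antiortholattice
    (PBZ.IsAntiortholattice PBZ.W ∧ PBZ.IsDistributive PBZ.W ∧ PBZ.IsSimple PBZ.W ∧
      PBZ.IsReduced PBZ.W ∧
      -- it has a subalgebra isomorphic to the four-element chain, and the equivalence that
      -- collapses only `a` and `a'` is a nontrivial pseudo-identical congruence of it
      ∃ S : PBZ.Subalg PBZ.W,
        S.carrier = {PBZ.W.zero, PBZ.W.a, PBZ.W.na, PBZ.W.one} ∧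
        Nonempty (PBZ.Iso S PBZ.D4) ∧
        PBZ.IsPBZStar S ∧
        ∃ θ : PBZ.Congruence S,
          (∀ x y : S, θ.r x y ↔
            x = y ∨ (x.1 ∈ ({PBZ.W.a, PBZ.W.na} : Set PBZ.W) ∧
              y.1 ∈ ({PBZ.W.a, PBZ.W.na} : Set PBZ.W))) ∧
          θ ≠ ⊥ ∧ θ.IsPseudoIdentical ∧ ¬ PBZ.IsReduced S) ∧
    -- the reduced PBZ*-lattices are not closed under subalgebras
    ¬ PBZ.ClosedUnderSubalgebras (PBZ.reducedMembers PBZ.PBZL) :=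
  ⟨PBZ.not_isEquivalential_PBZL,
    ⟨PBZ.W.isAntiortholattice, PBZ.W.isDistributive, PBZ.W.isSimple, PBZ.W.isReduced,
      PBZ.W.chain, rfl, ⟨PBZ.W.chainIso⟩, PBZ.W.isPBZStar.subalg _, PBZ.W.collapse,
      PBZ.W.collapse_rel_iff, PBZ.W.collapse_ne_bot, PBZ.W.collapse_isPseudoIdentical,
      PBZ.W.not_isReduced_chain⟩,
    PBZ.not_closedUnderSubalgebras_reducedMembers_PBZL⟩
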